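/- Let $k$ be a field of characteristic $0$. A representation of a Lie algebra over $k$ is regarded as a two-sorted algebra $H=(H^{(1)},H^{(2)})$, where $H^{(1)}$ is a Lie algebra over $k$ and $H^{(2)}$ is a vector space over $k$ on which it acts; the operations are $0^{(i)}$, $-^{(i)}$, $\lambda^{(i)}$ ($\lambda\in k$), $+^{(i)}$ for $i=1,2$, the bracket $[\,,]$ on the first sort, and the action $\circ$ (first sort times second sort into second sort). Fix countably infinite disjoint sets of variables $X_0^{(1)},X_0^{(2)}$. Let $\Theta$ be a variety of representations, that is, the class of all representations satisfying some set of identities. For finite $X=X^{(1)}\cup X^{(2)}$, $X^{(i)}\subset X_0^{(i)}$, let $F_\Theta(X)$ be the free representation of $\Theta$ on $X$: its first sort is $L(X^{(1)})/I_\Theta(X^{(1)})$, where $L(X^{(1)})$ is the free Lie algebra and $I_\Theta(X^{(1)})$ is the ideal of all $l$ such that the identity $l=0$ holds in $\Theta$; its second sort is the free left module with basis $X^{(2)}$ over the free associative unital algebra on $X^{(1)}$, modulo the submodule of all $v$ such that the identity $v=0$ holds in $\Theta$. $\Theta$ is called action-type if $I_\Theta(X^{(1)})=\{0\}$ for all finite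 $X^{(1)}\subset X_0^{(1)}$, and degenerated if the identity $[x_1^{(1)},x_2^{(1)}]\circ x^{(2)}=0$ holds in $\Theta$. A system of words $W$ consists of one element $w_\omega\in F_\omega$ for every operation $\omega$ above, where $F_\omega$ is the free representation of $\Theta$ generated by distinct variables, one for every argument of $\omega$ and of the sort of that argument, and $w_\omega$ has the sort of the result of $\omega$. For $H\in\Theta$ let $H_W^*$ be the pair of sets $(H^{(1)},H^{(2)})$ in which every operation $\omega$ is replaced by the verbal operation $(h_1,\dots,h_n)\mapsto\alpha(w_\omega)$, where $\alpha:F_\omega\to H$ is the homomorphism that sends the generators of $F_\omega$ to $h_1,\dots,h_n$. **Proposition.** Let $\Theta$ be an action-type variety of representations that is not degenerated. Let $W$ be a system of words such that for every finite $X$ there is a sort-preserving bijection $s_F:F\to F$ of $F=F_\Theta(X)$ with $s_F|_X=\mathrm{id}_X$ that is an isomorphism $F\to F_W^*$. Then there are $\varphi\in\mathrm{Aut}\,k$ and $a\in k^*$ such that $$w_{0^{(1)}}=0^{(1)},\quad w_{-^{(1)}}=-x^{(1)},\quad w_{\lambda^{(1)}}=\varphi(\lambda)x^{(1)}\ (\lambda\in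 k),\quad w_{+^{(1)}}=x_1^{(1)}+x_2^{(1)},\quad w_{[,]}=a[x_1^{(1)},x_2^{(1)}],$$ $$w_{0^{(2)}}=0^{(2)},\quad w_{-^{(2)}}=-x^{(2)},\quad w_{\lambda^{(2)}}=\varphi(\lambda)x^{(2)}\ (\lambda\in k),\quad w_{+^{(2)}}=x_1^{(2)}+x_2^{(2)},\quad w_{\circ}=a\,(x^{(1)}\circ x^{(2)}).$$ -/

import Mathlib

universe u

namespace LieRepresentation

/-- A representation of a Lie algebra over `k`: a Lie algebra `L`, a vector space `V` and a bilinear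
action `l ∘ v` of `L` on `V` such that `[x, y] ∘ v = x ∘ (y ∘ v) - y ∘ (x ∘ v)`. It is a two-sorted
algebra: `L` is the first sort and `V` is the second sort. -/
structure Rep (k : Type u) [Field k] where
  L : Type u
  V : Type u
  [lieRing : LieRing L]
  [lieAlgebra : LieAlgebra k L]
  [addCommGroup : AddCommGroup V]
  [module : Module k V]
  act : L →ₗ[k] V →ₗ[k] V
  act_lie : ∀ (x y : L) (v : V), act ⁅x, y⁆ v = act x (act y v) - act y (act x v)

attribute [instance] Rep.lieRing Rep.lieAlgebra Rep.addCommGroup Rep.module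

section AbsolutelyFree

attribute [local instance] LieRing.ofAssociativeRing LieAlgebra.ofAssociativeAlgebra

/-- The canonical homomorphism `ι : L(S) → A(S)` of the free Lie algebra into the free associative
algebra with unit, the latter taken with the commutator bracket. -/
noncomputable def iota (k : Type u) [Field k] (S : Type) : FreeLieAlgebra k S →ₗ[k] FreeAlgebra k S :=
  (FreeLieAlgebra.lift k (FreeAlgebra.ι k (X := S)) : FreeLieAlgebra k S →ₗ⁅k⁆ FreeAlgebra k S)

theorem iota_of (k : Type u) [Field k] (S : Type) (s : S) :
    iota k S (FreeLieAlgebra.of k s) = FreeAlgebra.ι k s := by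
  simp [iota]

theorem iota_lie (k : Type u) [Field k] (S : Type) (x y : FreeLieAlgebra k S) :
    iota k S ⁅x, y⁆ = iota k S x * iota k S y - iota k S y * iota k S x := by
  simp [iota, LieRing.of_associative_ring_bracket]

/-- The absolutely free representation generated by `S` (first sort) and `T` (second sort): the first
sort is the free Lie algebra `L(S)`, the second sort is the free left `A(S)`-module with basis `T`,
and `l ∘ v = ι(l) v`. -/
noncomputable def absFree (k : Type u) [Field k] (S T : Type) : Rep k where
  L := FreeLieAlgebra k S
  V := T →₀ FreeAlgebra k S
  act :=
    { toFun := fun l => (Algebra.lsmul k k (T →₀ FreeAlgebra k S)) (iota k S l)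
      map_add' := fun x y => by simp
      map_smul' := fun c x => by simp }
  act_lie := fun x y v => by
    simp [iota_lie]

/-- The first-sort component of the homomorphism from the absolutely free representation to `H` that
sends the generators of the first sort to the values of `f`. -/
noncomputable def evalL {k : Type u} [Field k] {S : Type} (H : Rep k) (f : S → H.L) :
    FreeLieAlgebra k S →ₗ⁅k⁆ H.L :=
  FreeLieAlgebra.lift k f

/-- The second-sort component of the homomorphism from the absolutely free representation to `H` that
sends the generators to the values of `f` and of `g`. -/
noncomputable def evalV {k : Type u} [Field k] {S T : Type} (H : Rep k) (f : S → H.L) (g : T → H.V) :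
    (T →₀ FreeAlgebra k S) →ₗ[k] H.V :=
  Finsupp.lsum k fun t =>
    (LinearMap.applyₗ (g t)).comp
      (FreeAlgebra.lift k (fun s => (H.act (f s) : Module.End k H.V))).toLinearMap

theorem evalL_of {k : Type u} [Field k] {S : Type} (H : Rep k) (f : S → H.L) (s : S) :
    evalL H f (FreeLieAlgebra.of k s) = f s := by
  simp [evalL]

theorem evalV_single {k : Type u} [Field k] {S T : Type} (H : Rep k) (f : S → H.L) (g : T → H.V)
    (t : T) (a : FreeAlgebra k S) :
    evalV H f g (Finsupp.single t a) =
      (FreeAlgebra.lift k (fun s => (H.act (f s) : Module.End k H.V)) a) (g t) := by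
  simp [evalV]

theorem lift_iota {k : Type u} [Field k] {S : Type} (H : Rep k) (f : S → H.L)
    (l : FreeLieAlgebra k S) :
    FreeAlgebra.lift k (fun s => (H.act (f s) : Module.End k H.V)) (iota k S l) =
      H.act (evalL H f l) := by
  let ρ : H.L →ₗ⁅k⁆ Module.End k H.V :=
    { H.act with
      map_lie' := fun {x y} => by
        ext v
        simp [LieRing.of_associative_ring_bracket, H.act_lie] }
  have h : ((FreeAlgebra.lift k (fun s => (H.act (f s) : Module.End k H.V))) :
        FreeAlgebra k S →ₗ⁅k⁆ Module.End k H.V).comp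
        (FreeLieAlgebra.lift k (FreeAlgebra.ι k (X := S))) = ρ.comp (evalL H f) := by
    apply FreeLieAlgebra.hom_ext
    intro s
    simp only [LieHom.comp_apply, evalL, FreeLieAlgebra.lift_of_apply]
    exact FreeAlgebra.lift_ι_apply _ s
  exact LieHom.congr_fun h l

/-- The two components respect the action, so together they form a homomorphism. -/
theorem evalV_act {k : Type u} [Field k] {S T : Type} (H : Rep k) (f : S → H.L) (g : T → H.V)
    (l : FreeLieAlgebra k S) (v : T →₀ FreeAlgebra k S) :
    evalV H f g (iota k S l • v) = H.act (evalL H f l) (evalV H f g v) := by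
  induction v using Finsupp.induction_linear with
  | zero => simp
  | add v w hv hw => rw [smul_add, map_add, map_add, map_add, hv, hw]
  | single t a =>
    rw [Finsupp.smul_single, evalV_single, evalV_single, smul_eq_mul, map_mul, lift_iota]
    rfl

/-- Homomorphisms commute with evaluation. -/
theorem evalL_comp {k : Type u} [Field k] {S : Type} {H H' : Rep k} (a : H.L →ₗ⁅k⁆ H'.L)
    (f : S → H.L) (l : FreeLieAlgebra k S) :
    evalL H' (fun s => a (f s)) l = a (evalL H f l) := by
  have h : evalL H' (fun s => a (f s)) = a.comp (evalL H f) := by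
    apply FreeLieAlgebra.hom_ext
    intro s
    simp [evalL]
  exact LieHom.congr_fun h l

theorem evalV_comp {k : Type u} [Field k] {S T : Type} {H H' : Rep k} (a : H.L →ₗ⁅k⁆ H'.L)
    (b : H.V →ₗ[k] H'.V) (hab : ∀ l v, b (H.act l v) = H'.act (a l) (b v))
    (f : S → H.L) (g : T → H.V) (v : T →₀ FreeAlgebra k S) :
    evalV H' (fun s => a (f s)) (fun t => b (g t)) v = b (evalV H f g v) := by
  have key : ∀ (c : FreeAlgebra k S) (w : H.V),
      (FreeAlgebra.lift k (fun s => (H'.act (a (f s)) : Module.End k H'.V)) c) (b w) =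
        b ((FreeAlgebra.lift k (fun s => (H.act (f s) : Module.End k H.V)) c) w) := by
    intro c
    induction c using FreeAlgebra.induction with
    | grade0 r => intro w; simp
    | grade1 s => intro w; simp [hab]
    | mul c d hc hd => intro w; rw [map_mul, map_mul, Module.End.mul_apply, hd, hc]; rfl
    | add c d hc hd =>
      intro w
      rw [map_add, map_add, LinearMap.add_apply, hc, hd, LinearMap.add_apply, map_add]
  induction v using Finsupp.induction_linear with
  | zero => simp
  | add v w hv hw => rw [map_add, map_add, map_add, hv, hw]
  | single t c => rw [evalV_single, evalV_single, key]

end AbsolutelyFree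

/-- `H` satisfies the identities `p.1 = p.2` for all `p ∈ E₁` (identities of the first sort) and all
`p ∈ E₂` (identities of the second sort). An identity is a pair of elements of the same sort of the
absolutely free representation in countably many variables of each sort. -/
def Satisfies {k : Type u} [Field k]
    (E₁ : Set (FreeLieAlgebra k ℕ × FreeLieAlgebra k ℕ))
    (E₂ : Set ((ℕ →₀ FreeAlgebra k ℕ) × (ℕ →₀ FreeAlgebra k ℕ))) (H : Rep k) : Prop :=
  ∀ (f : ℕ → H.L) (g : ℕ → H.V),
    (∀ p ∈ E₁, evalL H f p.1 = evalL H f p.2) ∧ (∀ p ∈ E₂, evalV H f g p.1 = evalV H f g p.2)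

/-- A variety of representations: the class of all representations that satisfy some set of
identities. -/
structure Variety (k : Type u) [Field k] where
  carrier : Set (Rep k)
  equational : ∃ (E₁ : Set (FreeLieAlgebra k ℕ × FreeLieAlgebra k ℕ))
    (E₂ : Set ((ℕ →₀ FreeAlgebra k ℕ) × (ℕ →₀ FreeAlgebra k ℕ))),
    ∀ H : Rep k, H ∈ carrier ↔ Satisfies E₁ E₂ H

namespace Variety

variable {k : Type u} [Field k] (Θ : Variety k)

/-- The ideal `I_Θ(X₁)` of `L(X₁)`: all `l` such that the identity `l = 0` holds in `Θ`. -/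
def idealI (X₁ : Finset ℕ) : LieIdeal k (FreeLieAlgebra k X₁) where
  carrier := {l | ∀ H ∈ Θ.carrier, ∀ f : X₁ → H.L, evalL H f l = 0}
  add_mem' := fun {a b} ha hb H hH f => by rw [map_add, ha H hH f, hb H hH f, add_zero]
  zero_mem' := fun H _ f => by rw [map_zero]
  smul_mem' := fun c a ha H hH f => by rw [map_smul, ha H hH f, smul_zero]
  lie_mem := fun {x m} hm H hH f => by rw [LieHom.map_lie, hm H hH f, lie_zero]

/-- The submodule `V_Θ(X)` of `A(X₁) X₂`: all `v` such that the identity `v = 0` holds in `Θ`. -/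
def subV (X₁ X₂ : Finset ℕ) : Submodule k (X₂ →₀ FreeAlgebra k X₁) where
  carrier := {v | ∀ H ∈ Θ.carrier, ∀ (f : X₁ → H.L) (g : X₂ → H.V), evalV H f g v = 0}
  add_mem' := fun {a b} ha hb H hH f g => by rw [map_add, ha H hH f g, hb H hH f g, add_zero]
  zero_mem' := fun H _ f g => by rw [map_zero]
  smul_mem' := fun c a ha H hH f g => by rw [map_smul, ha H hH f g, smul_zero]

theorem mem_idealI {X₁ : Finset ℕ} {l : FreeLieAlgebra k X₁} :
    l ∈ Θ.idealI X₁ ↔ ∀ H ∈ Θ.carrier, ∀ f : X₁ → H.L, evalL H f l = 0 := Iff.rfl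

theorem mem_subV {X₁ X₂ : Finset ℕ} {v : X₂ →₀ FreeAlgebra k X₁} :
    v ∈ Θ.subV X₁ X₂ ↔
      ∀ H ∈ Θ.carrier, ∀ (f : X₁ → H.L) (g : X₂ → H.V), evalV H f g v = 0 := Iff.rfl

theorem act_mem_subV (X₁ X₂ : Finset ℕ) (l : FreeLieAlgebra k X₁) :
    Θ.subV X₁ X₂ ≤ (Θ.subV X₁ X₂).comap ((absFree k X₁ X₂).act l) := by
  intro v hv H hH f g
  exact (evalV_act H f g l v).trans (by rw [hv H hH f g, map_zero])

/-- The action of `L(X₁)` on `A(X₁) X₂ / V_Θ(X)`. -/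
noncomputable def actQ (X₁ X₂ : Finset ℕ) :
    FreeLieAlgebra k X₁ →ₗ[k]
      ((X₂ →₀ FreeAlgebra k X₁) ⧸ Θ.subV X₁ X₂) →ₗ[k] ((X₂ →₀ FreeAlgebra k X₁) ⧸ Θ.subV X₁ X₂) where
  toFun := fun l => (Θ.subV X₁ X₂).mapQ (Θ.subV X₁ X₂) ((absFree k X₁ X₂).act l)
    (Θ.act_mem_subV X₁ X₂ l)
  map_add' := fun x y => by
    apply Submodule.linearMap_qext
    refine LinearMap.ext fun v => ?_
    exact congrArg (Submodule.Quotient.mk (p := Θ.subV X₁ X₂))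
      (LinearMap.congr_fun ((absFree k X₁ X₂).act.map_add x y) v)
  map_smul' := fun c x => by
    apply Submodule.linearMap_qext
    refine LinearMap.ext fun v => ?_
    exact congrArg (Submodule.Quotient.mk (p := Θ.subV X₁ X₂))
      (LinearMap.congr_fun ((absFree k X₁ X₂).act.map_smul c x) v)

theorem actQ_eq_zero (X₁ X₂ : Finset ℕ) :
    (Θ.idealI X₁).toSubmodule ≤ LinearMap.ker (Θ.actQ X₁ X₂) := by
  intro l hl
  rw [LinearMap.mem_ker]
  apply Submodule.linearMap_qext
  refine LinearMap.ext fun v => ?_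
  refine (Submodule.Quotient.mk_eq_zero (Θ.subV X₁ X₂)).2 ?_
  intro H hH f g
  exact (evalV_act H f g l v).trans (by
    rw [(Θ.mem_idealI.1 hl) H hH f, map_zero, LinearMap.zero_apply])

/-- The free representation `F_Θ(X)` of the variety `Θ` generated by a finite set `X` with
`X₁` generators of the first sort and `X₂` of the second one; the symbols of each sort are numbered by
`ℕ`. It is the quotient `L(X₁) / I_Θ(X₁)`, `A(X₁) X₂ / V_Θ(X)` of the absolutely free
representation by the congruence of all the identities of `Θ` in the variables `X`. -/
noncomputable def free (X₁ X₂ : Finset ℕ) : Rep k where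
  L := FreeLieAlgebra k X₁ ⧸ Θ.idealI X₁
  V := (X₂ →₀ FreeAlgebra k X₁) ⧸ Θ.subV X₁ X₂
  act := (Θ.idealI X₁).toSubmodule.liftQ (Θ.actQ X₁ X₂) (Θ.actQ_eq_zero X₁ X₂)
  act_lie := fun x y v => by
    induction x using Submodule.Quotient.induction_on with | _ x
    induction y using Submodule.Quotient.induction_on with | _ y
    induction v using Submodule.Quotient.induction_on with | _ v
    exact congrArg (Submodule.Quotient.mk (p := Θ.subV X₁ X₂)) ((absFree k X₁ X₂).act_lie x y v)

/-- The generators of the first sort of `F_Θ(X)`. -/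
noncomputable def gen₁ {X₁ X₂ : Finset ℕ} (x : X₁) : (Θ.free X₁ X₂).L :=
  LieSubmodule.Quotient.mk (N := Θ.idealI X₁) (FreeLieAlgebra.of k x)

/-- The generators of the second sort of `F_Θ(X)`. -/
noncomputable def gen₂ {X₁ X₂ : Finset ℕ} (y : X₂) : (Θ.free X₁ X₂).V :=
  Submodule.Quotient.mk (p := Θ.subV X₁ X₂) (Finsupp.single y 1)

/-- The first-sort component of the homomorphism `α : F_Θ(X) → H`, for `H ∈ Θ`, that sends the
generators to the values of `f` (and of any `g` in the second sort). -/
noncomputable def liftL {H : Rep k} (hH : H ∈ Θ.carrier) {X₁ X₂ : Finset ℕ} (f : X₁ → H.L) :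
    (Θ.free X₁ X₂).L →ₗ[k] H.L :=
  (Θ.idealI X₁).toSubmodule.liftQ (evalL H f : FreeLieAlgebra k X₁ →ₗ[k] H.L)
    fun _ hl => LinearMap.mem_ker.2 (Θ.mem_idealI.1 hl H hH f)

/-- The second-sort component of the homomorphism `α : F_Θ(X) → H`, for `H ∈ Θ`, that sends the
generators to the values of `f` and `g`. -/
noncomputable def liftV {H : Rep k} (hH : H ∈ Θ.carrier) {X₁ X₂ : Finset ℕ} (f : X₁ → H.L)
    (g : X₂ → H.V) : (Θ.free X₁ X₂).V →ₗ[k] H.V :=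
  (Θ.subV X₁ X₂).liftQ (evalV H f g) fun _ hv => LinearMap.mem_ker.2 (Θ.mem_subV.1 hv H hH f g)

theorem liftL_gen₁ {H : Rep k} (hH : H ∈ Θ.carrier) {X₁ X₂ : Finset ℕ} (f : X₁ → H.L) (x : X₁) :
    Θ.liftL hH f (Θ.gen₁ x : (Θ.free X₁ X₂).L) = f x :=
  evalL_of H f x

theorem liftV_gen₂ {H : Rep k} (hH : H ∈ Θ.carrier) {X₁ X₂ : Finset ℕ} (f : X₁ → H.L)
    (g : X₂ → H.V) (y : X₂) : Θ.liftV hH f g (Θ.gen₂ y : (Θ.free X₁ X₂).V) = g y := by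
  refine (evalV_single H f g y 1).trans ?_
  simp

theorem liftL_lie {H : Rep k} (hH : H ∈ Θ.carrier) {X₁ X₂ : Finset ℕ} (f : X₁ → H.L)
    (x y : (Θ.free X₁ X₂).L) : Θ.liftL hH f ⁅x, y⁆ = ⁅Θ.liftL hH f x, Θ.liftL hH f y⁆ := by
  induction x using Submodule.Quotient.induction_on with | _ x
  induction y using Submodule.Quotient.induction_on with | _ y
  exact LieHom.map_lie (evalL H f) x y

theorem liftV_act {H : Rep k} (hH : H ∈ Θ.carrier) {X₁ X₂ : Finset ℕ} (f : X₁ → H.L)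
    (g : X₂ → H.V) (l : (Θ.free X₁ X₂).L) (v : (Θ.free X₁ X₂).V) :
    Θ.liftV hH f g ((Θ.free X₁ X₂).act l v) = H.act (Θ.liftL hH f l) (Θ.liftV hH f g v) := by
  induction l using Submodule.Quotient.induction_on with | _ l
  induction v using Submodule.Quotient.induction_on with | _ v
  exact evalV_act H f g l v

/-- `F_Θ(X)` belongs to `Θ`. -/
theorem free_mem (X₁ X₂ : Finset ℕ) : Θ.free X₁ X₂ ∈ Θ.carrier := by
  obtain ⟨E₁, E₂, hE⟩ := Θ.equational
  rw [hE]
  intro f g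
  let a : (absFree k X₁ X₂).L →ₗ⁅k⁆ (Θ.free X₁ X₂).L :=
    { (Θ.idealI X₁).toSubmodule.mkQ with map_lie' := fun {_ _} => rfl }
  let b : (absFree k X₁ X₂).V →ₗ[k] (Θ.free X₁ X₂).V := (Θ.subV X₁ X₂).mkQ
  have ha : Function.Surjective a := Submodule.Quotient.mk_surjective (Θ.idealI X₁).toSubmodule
  have hb : Function.Surjective b := Submodule.Quotient.mk_surjective (Θ.subV X₁ X₂)
  choose f' hf' using fun n => ha (f n)
  choose g' hg' using fun n => hb (g n)
  obtain rfl : (fun n => a (f' n)) = f := funext hf'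
  obtain rfl : (fun n => b (g' n)) = g := funext hg'
  constructor
  · intro p hp
    rw [evalL_comp a f', evalL_comp a f']
    refine (Submodule.Quotient.eq (Θ.idealI X₁).toSubmodule).2 ?_
    intro H hH φ
    refine (map_sub (evalL H φ) _ _).trans (sub_eq_zero.2 ?_)
    have h := (((hE H).1 hH) (fun n => evalL H φ (f' n)) (fun _ => 0)).1 p hp
    exact ((evalL_comp (H := absFree k X₁ X₂) (evalL H φ) f' p.1).symm.trans h).trans
      (evalL_comp (H := absFree k X₁ X₂) (evalL H φ) f' p.2)
  · intro p hp
    rw [evalV_comp a b (fun _ _ => rfl) f' g', evalV_comp a b (fun _ _ => rfl) f' g']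
    refine (Submodule.Quotient.eq (Θ.subV X₁ X₂)).2 ?_
    intro H hH φ ψ
    refine (map_sub (evalV H φ ψ) _ _).trans (sub_eq_zero.2 ?_)
    have h := (((hE H).1 hH) (fun n => evalL H φ (f' n)) (fun n => evalV H φ ψ (g' n))).2 p hp
    exact ((evalV_comp (H := absFree k X₁ X₂) (evalL H φ) (evalV H φ ψ)
        (fun l v => evalV_act H φ ψ l v) f' g' p.1).symm.trans h).trans
      (evalV_comp (H := absFree k X₁ X₂) (evalL H φ) (evalV H φ ψ)
        (fun l v => evalV_act H φ ψ l v) f' g' p.2)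

/-- `Θ` is an action-type variety: all the ideals `I_Θ(X₁)` are zero. -/
def IsActionType : Prop :=
  ∀ X₁ : Finset ℕ, Θ.idealI X₁ = ⊥

/-- `Θ` is degenerated: the identity `[x₁, x₂] ∘ y = 0` holds in `Θ`. -/
def IsDegenerated : Prop :=
  ∀ H ∈ Θ.carrier, ∀ (x₁ x₂ : H.L) (y : H.V), H.act ⁅x₁, x₂⁆ y = 0

end Variety

/-- The operations of the signature of representations on a pair of sets, without any laws. -/
structure Operations (k : Type u) (A₁ A₂ : Type u) where
  zero₁ : A₁
  neg₁ : A₁ → A₁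
  smul₁ : k → A₁ → A₁
  add₁ : A₁ → A₁ → A₁
  bracket : A₁ → A₁ → A₁
  zero₂ : A₂
  neg₂ : A₂ → A₂
  smul₂ : k → A₂ → A₂
  add₂ : A₂ → A₂ → A₂
  act : A₁ → A₂ → A₂

/-- The standard operations of a representation. -/
def Rep.operations {k : Type u} [Field k] (H : Rep k) : Operations k H.L H.V where
  zero₁ := 0
  neg₁ := fun x => -x
  smul₁ := fun c x => c • x
  add₁ := fun x y => x + y
  bracket := fun x y => ⁅x, y⁆
  zero₂ := 0
  neg₂ := fun v => -v
  smul₂ := fun c v => c • v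
  add₂ := fun v w => v + w
  act := fun x v => H.act x v

/-- A pair of maps (one for each sort) is a homomorphism of two-sorted algebras. -/
structure IsHom {k A₁ A₂ B₁ B₂ : Type u} (P : Operations k A₁ A₂) (Q : Operations k B₁ B₂)
    (s₁ : A₁ → B₁) (s₂ : A₂ → B₂) : Prop where
  zero₁ : s₁ P.zero₁ = Q.zero₁
  neg₁ : ∀ x, s₁ (P.neg₁ x) = Q.neg₁ (s₁ x)
  smul₁ : ∀ c x, s₁ (P.smul₁ c x) = Q.smul₁ c (s₁ x)
  add₁ : ∀ x y, s₁ (P.add₁ x y) = Q.add₁ (s₁ x) (s₁ y)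
  bracket : ∀ x y, s₁ (P.bracket x y) = Q.bracket (s₁ x) (s₁ y)
  zero₂ : s₂ P.zero₂ = Q.zero₂
  neg₂ : ∀ v, s₂ (P.neg₂ v) = Q.neg₂ (s₂ v)
  smul₂ : ∀ c v, s₂ (P.smul₂ c v) = Q.smul₂ c (s₂ v)
  add₂ : ∀ v w, s₂ (P.add₂ v w) = Q.add₂ (s₂ v) (s₂ w)
  act : ∀ x v, s₂ (P.act x v) = Q.act (s₁ x) (s₂ v)

/-- The variable number `0` of a one-element set of variables. -/
abbrev var : ({0} : Finset ℕ) := ⟨0, by simp⟩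

/-- The first of two variables. -/
abbrev var₁ : ({0, 1} : Finset ℕ) := ⟨0, by simp⟩

/-- The second of two variables. -/
abbrev var₂ : ({0, 1} : Finset ℕ) := ⟨1, by simp⟩

/-- The assignment of values to no variables. -/
def assign₀ {A : Type u} : (∅ : Finset ℕ) → A := fun i => absurd i.2 (Finset.notMem_empty i.1)

/-- The assignment of a value to one variable. -/
def assign₁ {A : Type u} (h : A) : ({0} : Finset ℕ) → A := fun _ => h

/-- The assignment of values to two variables. -/
def assign₂ {A : Type u} (h₁ h₂ : A) : ({0, 1} : Finset ℕ) → A :=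
  fun i => if i.1 = 0 then h₁ else h₂

/-- A system of words `W = {w_ω ∈ F_ω | ω ∈ Ω}`: one word for every operation `ω` of the signature,
in the free representation `F_ω` of `Θ` whose free generators are the arguments of `ω`; the word has
the sort of the result of `ω`. -/
structure WordSystem {k : Type u} [Field k] (Θ : Variety k) where
  zero₁ : (Θ.free ∅ ∅).L
  neg₁ : (Θ.free {0} ∅).L
  smul₁ : k → (Θ.free {0} ∅).L
  add₁ : (Θ.free {0, 1} ∅).L
  bracket : (Θ.free {0, 1} ∅).L
  zero₂ : (Θ.free ∅ ∅).V
  neg₂ : (Θ.free ∅ {0}).V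
  smul₂ : k → (Θ.free ∅ {0}).V
  add₂ : (Θ.free ∅ {0, 1}).V
  act : (Θ.free {0} {0}).V

namespace WordSystem

variable {k : Type u} [Field k] {Θ : Variety k}

/-- The algebra `H_W^*`: the verbal operations defined by the words of `W` on the carriers of a
representation `H ∈ Θ`. The verbal operation of a word `w` sends `h₁, …, hₙ` to `α(w)`, where
`α` is the homomorphism to `H` that sends the generators to `h₁, …, hₙ`. -/
noncomputable def operations (W : WordSystem Θ) {H : Rep k} (hH : H ∈ Θ.carrier) :
    Operations k H.L H.V where
  zero₁ := Θ.liftL hH assign₀ W.zero₁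
  neg₁ := fun x => Θ.liftL hH (assign₁ x) W.neg₁
  smul₁ := fun c x => Θ.liftL hH (assign₁ x) (W.smul₁ c)
  add₁ := fun x y => Θ.liftL hH (assign₂ x y) W.add₁
  bracket := fun x y => Θ.liftL hH (assign₂ x y) W.bracket
  zero₂ := Θ.liftV hH assign₀ assign₀ W.zero₂
  neg₂ := fun v => Θ.liftV hH assign₀ (assign₁ v) W.neg₂
  smul₂ := fun c v => Θ.liftV hH assign₀ (assign₁ v) (W.smul₂ c)
  add₂ := fun v w => Θ.liftV hH assign₀ (assign₂ v w) W.add₂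
  act := fun x v => Θ.liftV hH (assign₁ x) (assign₁ v) W.act

/-- The condition on a system of words `W`: for every finite `X` there is a sort-preserving bijection
`s` of `F = F_Θ(X)` onto itself that fixes the free generators and is an isomorphism from `F` to
`F_W^*`. -/
def IsVerbal (W : WordSystem Θ) : Prop :=
  ∀ X₁ X₂ : Finset ℕ,
    ∃ (s₁ : (Θ.free X₁ X₂).L ≃ (Θ.free X₁ X₂).L) (s₂ : (Θ.free X₁ X₂).V ≃ (Θ.free X₁ X₂).V),
      (∀ x : X₁, s₁ (Θ.gen₁ x) = Θ.gen₁ x) ∧ (∀ y : X₂, s₂ (Θ.gen₂ y) = Θ.gen₂ y) ∧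
      IsHom (Θ.free X₁ X₂).operations (W.operations (Θ.free_mem X₁ X₂)) s₁ s₂

end WordSystem

end LieRepresentation

open LieRepresentation

/-!
Multiplying each generator `x` of the first sort by a scalar `c x` extends to an endomorphism of
`F = F_Θ(X)`. The isomorphism `s : F → F_W^*` fixes the generators and turns scalar multiplication
by `c` into scalar multiplication by `φ c`, so it conjugates the diagonal endomorphism of `c` into
that of `φ ∘ c`. A word of `W` is the image under `s` of the corresponding operation applied to
generators, hence a simultaneous eigenvector: for all `c` in the case of the bracket, for the
constant `c` in the case of the sum and the action. Over an infinite field it is then a combination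
of monomials of the same multidegree, or of the same degree: in degree one these are the generators
themselves, and the only Lie monomials linear in both `x₁` and `x₂` are `± [x₁, x₂]`.

If `ψ` describes the scalars of the second sort, then `ψ c` is the eigenvalue of the word of the
action at `φ c`, so `ψ = φ ^ n` with `n` the degree of that word in the first sort. The inverse of
`s` gives `φ = ψ ^ m` in the same way, hence `n = 1` and `φ = ψ`. Finally, the coefficients of the
bracket and of the action agree because `[x₁, x₂] ∘ y` is both an iterated action and the action of
a bracket, and it is nonzero in `F` when `Θ` is not degenerated.
-/

namespace LieRepresentation

section WeightVectors

variable {k M ι κ J : Type*} [Field k] [AddCommGroup M] [Module k M]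

theorem iSupIndep_iInf_eigenspace (D : J → Module.End k M) :
    iSupIndep fun χ : J → k => ⨅ j, (D j).eigenspace (χ j) := by
  classical
  rw [iSupIndep_iff_finsetSum_eq_zero_imp_eq_zero]
  intro s
  induction s using Finset.induction_on with
  | empty => simp
  | insert χ₀ s hχ₀ ih =>
    intro v hv hsum
    have hD : ∀ χ ∈ insert χ₀ s, ∀ j, D j (v χ) = χ j • v χ := fun χ hχ j =>
      Module.End.mem_eigenspace_iff.1 (Submodule.mem_iInf _ |>.1 (hv χ hχ) j)
    have hdiff : ∀ j, ∑ χ ∈ s, (χ j - χ₀ j) • v χ = 0 := fun j => by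
      have h : ∑ χ ∈ insert χ₀ s, (χ j - χ₀ j) • v χ = D j (∑ χ ∈ insert χ₀ s, v χ) -
          χ₀ j • ∑ χ ∈ insert χ₀ s, v χ := by
        rw [map_sum, Finset.smul_sum, ← Finset.sum_sub_distrib]
        exact Finset.sum_congr rfl fun χ hχ => by rw [hD χ hχ, sub_smul]
      rwa [hsum, map_zero, smul_zero, sub_zero, Finset.sum_insert hχ₀, sub_self, zero_smul,
        zero_add] at h
    have hs : ∀ χ ∈ s, v χ = 0 := fun χ hχ => by
      obtain ⟨j, hj⟩ := Function.ne_iff.1 (ne_of_mem_of_not_mem hχ hχ₀)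
      have h := ih (fun χ => (χ j - χ₀ j) • v χ)
        (fun χ hχ => Submodule.smul_mem _ _ (hv χ (Finset.mem_insert_of_mem hχ))) (hdiff j) χ hχ
      exact (smul_eq_zero.1 h).resolve_left (sub_ne_zero.2 hj)
    rw [Finset.sum_insert hχ₀, Finset.sum_eq_zero hs, add_zero] at hsum
    exact Finset.forall_mem_insert _ _ _ |>.2 ⟨hsum, hs⟩

theorem mem_span_image_of_forall_eq_smul {D : J → Module.End k M} {e : ι → M} {μ : ι → J → k}
    (he : ∀ i j, D j (e i) = μ i j • e i) (htop : Submodule.span k (Set.range e) = ⊤)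
    {χ : J → k} {v : M} (hv : ∀ j, D j v = χ j • v) :
    v ∈ Submodule.span k (e '' {i | μ i = χ}) := by
  let E (χ : J → k) : Submodule k M := ⨅ j, (D j).eigenspace (χ j)
  have mem_E {χ : J → k} {u : M} : u ∈ E χ ↔ ∀ j, D j u = χ j • u := by
    simp only [E, Submodule.mem_iInf, Module.End.mem_eigenspace_iff]
  have hother : Submodule.span k (e '' {i | μ i = χ}ᶜ) ≤ ⨆ (χ') (_ : χ' ≠ χ), E χ' :=
    Submodule.span_le.2 <| Set.image_subset_iff.2 fun i hi =>
      Submodule.mem_iSup_of_mem (μ i) (Submodule.mem_iSup_of_mem hi (mem_E.2 (he i)))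
  have hsame : Submodule.span k (e '' {i | μ i = χ}) ≤ E χ :=
    Submodule.span_le.2 <| Set.image_subset_iff.2 fun i hi => mem_E.2 fun j => by
      rw [he, show μ i = χ from hi]
  have hv_mem : v ∈ Submodule.span k (e '' {i | μ i = χ}) ⊔
      Submodule.span k (e '' {i | μ i = χ}ᶜ) := by
    rw [← Submodule.span_union, ← Set.image_union, Set.union_compl_self, Set.image_univ, htop]
    trivial
  obtain ⟨t, ht, w, hw, rfl⟩ := Submodule.mem_sup.1 hv_mem
  have hwE : w ∈ E χ := by
    simpa using Submodule.sub_mem _ (mem_E.2 hv) (hsame ht)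
  have hw0 : w = 0 :=
    Submodule.disjoint_def.1 (iSupIndep_iInf_eigenspace D χ) w hwE (hother hw)
  rwa [hw0, add_zero]

/-- The vector `A x₁ (A x₂ (⋯ (A xₙ (b y))))` attached to the word `x₁ x₂ ⋯ xₙ` and to `y`. For the
adjoint action of the generators of a Lie algebra on the generators these are the right-normed
brackets. -/
def wordVector (A : ι → Module.End k M) (b : κ → M) (p : List ι × κ) : M :=
  (p.1.map A).prod (b p.2)

theorem wordVector_nil (A : ι → Module.End k M) (b : κ → M) (y : κ) :
    wordVector A b ([], y) = b y := rfl

theorem wordVector_cons (A : ι → Module.End k M) (b : κ → M) (x : ι) (w : List ι) (y : κ) :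
    wordVector A b (x :: w, y) = A x (wordVector A b (w, y)) := by
  rw [wordVector, List.map_cons, List.prod_cons, Module.End.mul_apply, wordVector]

theorem span_range_wordVector {A : ι → Module.End k M} {b : κ → M}
    (hgen : ∀ N : Submodule k M, (∀ y, b y ∈ N) → (∀ x, ∀ v ∈ N, A x v ∈ N) → N = ⊤) :
    Submodule.span k (Set.range (wordVector A b)) = ⊤ := by
  refine hgen _ (fun y => Submodule.subset_span ⟨([], y), rfl⟩) fun x v hv => ?_
  have hle : Submodule.span k (Set.range (wordVector A b)) ≤
      (Submodule.span k (Set.range (wordVector A b))).comap (A x) := by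
    rw [Submodule.span_le]
    rintro _ ⟨⟨w, y⟩, rfl⟩
    exact Submodule.subset_span ⟨(x :: w, y), wordVector_cons A b x w y⟩
  exact hle hv

theorem map_wordVector {A : ι → Module.End k M} {b : κ → M} {D : Module.End k M} {α : ι → k}
    {β : κ → k} (hb : ∀ y, D (b y) = β y • b y) (hA : ∀ x v, D (A x v) = α x • A x (D v))
    (p : List ι × κ) :
    D (wordVector A b p) = ((p.1.map α).prod * β p.2) • wordVector A b p := by
  obtain ⟨w, y⟩ := p
  induction w with
  | nil => simp [wordVector_nil, hb]
  | cons x w ih =>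
    rw [wordVector_cons, hA, ih, map_smul, smul_smul, List.map_cons, List.prod_cons, mul_assoc]

end WeightVectors

section InfiniteField

variable {k : Type*} [Field k]

theorem eq_of_forall_pow_eq_pow [Infinite k] {m n : ℕ} (h : ∀ c : k, c ^ m = c ^ n) : m = n := by
  have hX : (Polynomial.X ^ m : Polynomial k) = Polynomial.X ^ n :=
    Polynomial.funext fun c => by simp [h c]
  simpa using congrArg Polynomial.natDegree hX

theorem perm_of_forall_prod_map_eq_prod_map [Infinite k] {ι : Type*} {w w' : List ι}
    (h : ∀ c : ι → k, (w.map c).prod = (w'.map c).prod) : w.Perm w' := by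
  classical
  refine List.perm_iff_count.2 fun x => eq_of_forall_pow_eq_pow (k := k) fun t => ?_
  let c : ι → k := Function.update (fun _ => 1) x t
  have hcount (w : List ι) : (w.map c).prod = t ^ w.count x := by
    rw [List.prod_map_eq_pow_single x c fun y hy _ => Function.update_of_ne hy _ _]
    simp only [c, Function.update_self]
  rw [← hcount, ← hcount, h]

end InfiniteField

section OneDimensional

variable {k M : Type*} [Field k] [AddCommGroup M] [Module k M] {g : M}

theorem exists_mulEquiv_of_map_smul (hg : g ≠ 0) (hspan : ∀ v : M, ∃ c : k, c • g = v)
    (s : M ≃ M) (hsg : s g = g) {φ : k → k} (hs : ∀ c v, s (c • v) = φ c • s v) :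
    ∃ ψ : k ≃* k, ∀ c, ψ c = φ c := by
  have hcancel : ∀ {c d : k}, c • g = d • g → c = d := fun h => smul_left_injective k hg h
  have hsg' : ∀ c, s (c • g) = φ c • g := fun c => by rw [hs, hsg]
  have hmul : ∀ c d, φ (c * d) = φ c * φ d := fun c d => hcancel <| by
    rw [← hsg', mul_smul, hs, hsg', mul_smul]
  have hinj : Function.Injective φ := fun c d h => hcancel <| s.injective <| by
    rw [hsg', hsg', h]
  have hsurj : Function.Surjective φ := fun d => by
    obtain ⟨c, hc⟩ := hspan (s.symm (d • g))
    exact ⟨c, hcancel <| by rw [← hsg', hc, s.apply_symm_apply]⟩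
  exact ⟨MulEquiv.ofBijective (⟨φ, hmul⟩ : k →ₙ* k) ⟨hinj, hsurj⟩, fun _ => rfl⟩

theorem eq_one_and_eq_one_of_map_add (hg : g ≠ 0) {s : M → M} (hs₀ : s 0 = 0) (hsg : s g = g)
    {c d : k} (hs : ∀ u v, s (u + v) = c • s u + d • s v) : c = 1 ∧ d = 1 := by
  constructor
  · have h := hs g 0
    rw [hs₀, add_zero, smul_zero, add_zero, hsg] at h
    exact smul_left_injective k hg (h.symm.trans (one_smul k g).symm)
  · have h := hs 0 g
    rw [hs₀, zero_add, smul_zero, zero_add, hsg] at h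
    exact smul_left_injective k hg (h.symm.trans (one_smul k g).symm)

end OneDimensional

section IsHom

variable {k A₁ A₂ B₁ B₂ C₁ C₂ : Type u} {P : Operations k A₁ A₂} {Q : Operations k B₁ B₂}
  {R : Operations k C₁ C₂}

theorem IsHom.id (P : Operations k A₁ A₂) : IsHom P P id id := by
  constructor <;> intros <;> rfl

theorem IsHom.comp {s₁ : A₁ → B₁} {s₂ : A₂ → B₂} {t₁ : B₁ → C₁} {t₂ : B₂ → C₂}
    (hs : IsHom P Q s₁ s₂) (ht : IsHom Q R t₁ t₂) : IsHom P R (t₁ ∘ s₁) (t₂ ∘ s₂) where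
  zero₁ := (congrArg t₁ hs.zero₁).trans ht.zero₁
  neg₁ _ := (congrArg t₁ (hs.neg₁ _)).trans (ht.neg₁ _)
  smul₁ _ _ := (congrArg t₁ (hs.smul₁ _ _)).trans (ht.smul₁ _ _)
  add₁ _ _ := (congrArg t₁ (hs.add₁ _ _)).trans (ht.add₁ _ _)
  bracket _ _ := (congrArg t₁ (hs.bracket _ _)).trans (ht.bracket _ _)
  zero₂ := (congrArg t₂ hs.zero₂).trans ht.zero₂
  neg₂ _ := (congrArg t₂ (hs.neg₂ _)).trans (ht.neg₂ _)
  smul₂ _ _ := (congrArg t₂ (hs.smul₂ _ _)).trans (ht.smul₂ _ _)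
  add₂ _ _ := (congrArg t₂ (hs.add₂ _ _)).trans (ht.add₂ _ _)
  act _ _ := (congrArg t₂ (hs.act _ _)).trans (ht.act _ _)

end IsHom

section Assignments

variable {A B : Type u}

theorem comp_assign₀ (a : A → B) : a ∘ assign₀ = assign₀ :=
  funext fun x => absurd x.2 (Finset.notMem_empty x.1)

theorem comp_assign₁ (a : A → B) (h : A) : a ∘ assign₁ h = assign₁ (a h) := rfl

theorem comp_assign₂ (a : A → B) (h₁ h₂ : A) : a ∘ assign₂ h₁ h₂ = assign₂ (a h₁) (a h₂) :=
  funext fun x => apply_ite a (x.1 = 0) h₁ h₂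

theorem assign₀_eq (f : (∅ : Finset ℕ) → A) : assign₀ = f :=
  funext fun x => absurd x.2 (Finset.notMem_empty x.1)

theorem assign₁_apply_var (f : ({0} : Finset ℕ) → A) : assign₁ (f var) = f :=
  funext fun x => congrArg f (Subsingleton.elim var x)

theorem range_eq_singleton_of_subsingleton {ι : Type*} [Subsingleton ι] (f : ι → A) (i : ι) :
    Set.range f = {f i} :=
  (Set.subsingleton_range f).eq_singleton_of_mem (Set.mem_range_self i)

theorem eq_var₁_or_eq_var₂ (x : ({0, 1} : Finset ℕ)) : x = var₁ ∨ x = var₂ := by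
  obtain ⟨x, hx⟩ := x
  simpa [Subtype.ext_iff] using hx

theorem range_eq_pair_of_var (f : ({0, 1} : Finset ℕ) → A) :
    Set.range f = {f var₁, f var₂} := by
  ext v
  refine ⟨?_, ?_⟩
  · rintro ⟨x, rfl⟩
    rcases eq_var₁_or_eq_var₂ x with rfl | rfl <;> simp
  · rintro (rfl | rfl) <;> exact Set.mem_range_self _

theorem assign₂_apply_var (f : ({0, 1} : Finset ℕ) → A) : assign₂ (f var₁) (f var₂) = f :=
  funext fun x => by rcases eq_var₁_or_eq_var₂ x with rfl | rfl <;> rfl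

end Assignments

namespace Variety

variable {k : Type u} [Field k] (Θ : Variety k)

section Generation

variable {Θ} {X₁ X₂ : Finset ℕ}

theorem lieSubalgebra_eq_top_of_gen₁_mem {N : LieSubalgebra k (Θ.free X₁ X₂).L}
    (hgen : ∀ x, Θ.gen₁ x ∈ N) : N = ⊤ := by
  let e : FreeLieAlgebra k X₁ →ₗ⁅k⁆ N := FreeLieAlgebra.lift k fun x => ⟨Θ.gen₁ x, hgen x⟩
  let mk : FreeLieAlgebra k X₁ →ₗ⁅k⁆ (Θ.free X₁ X₂).L :=
    { (Θ.idealI X₁).toSubmodule.mkQ with map_lie' := fun {_ _} => rfl }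
  have hmk : N.incl.comp e = mk := FreeLieAlgebra.hom_ext fun x => by
    simp only [LieHom.comp_apply, e, FreeLieAlgebra.lift_of_apply]
    rfl
  refine eq_top_iff.2 fun l _ => ?_
  obtain ⟨l, rfl⟩ := Submodule.Quotient.mk_surjective (Θ.idealI X₁).toSubmodule l
  have hl : N.incl (e l) = (Submodule.Quotient.mk l : (Θ.free X₁ X₂).L) :=
    LieHom.congr_fun hmk l
  exact hl ▸ (e l).2

theorem submodule_eq_top_of_gen₁_mem {N : Submodule k (Θ.free X₁ X₂).L}
    (hgen : ∀ x, Θ.gen₁ x ∈ N)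
    (hlie : ∀ x, ∀ v ∈ N, ⁅(Θ.gen₁ x : (Θ.free X₁ X₂).L), v⁆ ∈ N) : N = ⊤ := by
  let T : LieSubalgebra k (Θ.free X₁ X₂).L :=
    { carrier := {u | ∀ v ∈ N, ⁅u, v⁆ ∈ N}
      zero_mem' := fun v _ => by rw [zero_lie]; exact N.zero_mem
      add_mem' := fun ha hb v hv => by rw [add_lie]; exact N.add_mem (ha v hv) (hb v hv)
      smul_mem' := fun c u hu v hv => by rw [smul_lie]; exact N.smul_mem c (hu v hv)
      lie_mem' := fun ha hb v hv => by
        rw [lie_lie]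
        exact N.sub_mem (ha _ (hb v hv)) (hb _ (ha v hv)) }
  have hT : T = ⊤ := lieSubalgebra_eq_top_of_gen₁_mem hlie
  let N' : LieSubalgebra k (Θ.free X₁ X₂).L :=
    { N with lie_mem' := fun {u v} _ hv => (hT ▸ LieSubalgebra.mem_top u : u ∈ T) v hv }
  have hN' : N' = ⊤ := lieSubalgebra_eq_top_of_gen₁_mem hgen
  exact congrArg LieSubalgebra.toSubmodule hN'

theorem submodule_eq_top_of_gen₂_mem {N : Submodule k (Θ.free X₁ X₂).V}
    (hgen : ∀ y, Θ.gen₂ y ∈ N)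
    (hact : ∀ x, ∀ v ∈ N, (Θ.free X₁ X₂).act (Θ.gen₁ x) v ∈ N) : N = ⊤ := by
  let N' : Submodule k (X₂ →₀ FreeAlgebra k X₁) := N.comap (Θ.subV X₁ X₂).mkQ
  have hsmul (a : FreeAlgebra k X₁) : ∀ v ∈ N', a • v ∈ N' := by
    induction a using FreeAlgebra.induction with
    | grade0 r => exact fun v hv => algebraMap_smul (FreeAlgebra k X₁) r v ▸ N'.smul_mem r hv
    | grade1 x => exact fun v hv => iota_of k _ x ▸ hact x _ hv
    | mul a b ha hb => exact fun v hv => mul_smul a b v ▸ ha _ (hb v hv)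
    | add a b ha hb => exact fun v hv => add_smul a b v ▸ N'.add_mem (ha v hv) (hb v hv)
  have htop : N' = ⊤ := eq_top_iff.2 fun v _ => by
    induction v using Finsupp.induction_linear with
    | zero => exact N'.zero_mem
    | add v w hv hw => exact N'.add_mem (hv trivial) (hw trivial)
    | single y a => simpa using hsmul a (Finsupp.single y 1) (hgen y)
  exact Submodule.comap_injective_of_surjective (Submodule.mkQ_surjective _)
    (htop.trans (Submodule.comap_top _).symm)

end Generation

section Hom

variable {Θ} {X₁ X₂ : Finset ℕ}

section Ext

variable {B₁ B₂ : Type u} {Q : Operations k B₁ B₂} {s₁ t₁ : (Θ.free X₁ X₂).L → B₁}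
  {s₂ t₂ : (Θ.free X₁ X₂).V → B₂}

theorem free_hom_ext₁ (hs : IsHom (Θ.free X₁ X₂).operations Q s₁ s₂)
    (ht : IsHom (Θ.free X₁ X₂).operations Q t₁ t₂) (h₁ : ∀ x, s₁ (Θ.gen₁ x) = t₁ (Θ.gen₁ x)) :
    s₁ = t₁ := by
  let N : LieSubalgebra k (Θ.free X₁ X₂).L :=
    { carrier := {l | s₁ l = t₁ l}
      zero_mem' := hs.zero₁.trans ht.zero₁.symm
      add_mem' := fun {x y} (hx : s₁ x = t₁ x) (hy : s₁ y = t₁ y) => by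
        exact (hs.add₁ x y).trans (by rw [hx, hy]; exact (ht.add₁ x y).symm)
      smul_mem' := fun c {x} (hx : s₁ x = t₁ x) => by
        exact (hs.smul₁ c x).trans (by rw [hx]; exact (ht.smul₁ c x).symm)
      lie_mem' := fun {x y} (hx : s₁ x = t₁ x) (hy : s₁ y = t₁ y) => by
        exact (hs.bracket x y).trans (by rw [hx, hy]; exact (ht.bracket x y).symm) }
  have hN : N = ⊤ := lieSubalgebra_eq_top_of_gen₁_mem h₁
  exact funext fun l => (hN ▸ LieSubalgebra.mem_top l : l ∈ N)

theorem free_hom_ext₂ (hs : IsHom (Θ.free X₁ X₂).operations Q s₁ s₂)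
    (ht : IsHom (Θ.free X₁ X₂).operations Q t₁ t₂) (h₁ : ∀ x, s₁ (Θ.gen₁ x) = t₁ (Θ.gen₁ x))
    (h₂ : ∀ y, s₂ (Θ.gen₂ y) = t₂ (Θ.gen₂ y)) : s₂ = t₂ := by
  let N : Submodule k (Θ.free X₁ X₂).V :=
    { carrier := {v | s₂ v = t₂ v}
      zero_mem' := hs.zero₂.trans ht.zero₂.symm
      add_mem' := fun {v w} (hv : s₂ v = t₂ v) (hw : s₂ w = t₂ w) => by
        exact (hs.add₂ v w).trans (by rw [hv, hw]; exact (ht.add₂ v w).symm)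
      smul_mem' := fun c v (hv : s₂ v = t₂ v) => by
        exact (hs.smul₂ c v).trans (by rw [hv]; exact (ht.smul₂ c v).symm) }
  have hN : N = ⊤ := submodule_eq_top_of_gen₂_mem h₂ fun x v (hv : s₂ v = t₂ v) =>
    (hs.act _ v).trans (by rw [hv, h₁]; exact (ht.act _ v).symm)
  exact funext fun v => (hN ▸ Submodule.mem_top : v ∈ N)

end Ext

variable {H : Rep k} (hH : H ∈ Θ.carrier)

theorem isHom_lift (f : X₁ → H.L) (g : X₂ → H.V) :
    IsHom (Θ.free X₁ X₂).operations H.operations (Θ.liftL hH f) (Θ.liftV hH f g) where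
  zero₁ := map_zero _
  neg₁ := map_neg _
  smul₁ := map_smul _
  add₁ := map_add _
  bracket := Θ.liftL_lie hH f
  zero₂ := map_zero _
  neg₂ := map_neg _
  smul₂ := map_smul _
  add₂ := map_add _
  act := Θ.liftV_act hH f g

variable {hH} {H' : Rep k} {hH' : H' ∈ Θ.carrier} {a : H.L → H'.L} {b : H.V → H'.V}

theorem hom_liftL (h : IsHom H.operations H'.operations a b) (f : X₁ → H.L)
    (l : (Θ.free X₁ X₂).L) : a (Θ.liftL hH f l) = Θ.liftL hH' (a ∘ f) l :=
  congrFun (free_hom_ext₁ ((isHom_lift hH f 0).comp h) (isHom_lift hH' (a ∘ f) 0) fun x => by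
    simp only [Function.comp_apply, liftL_gen₁]) l

theorem hom_liftV (h : IsHom H.operations H'.operations a b) (f : X₁ → H.L) (g : X₂ → H.V)
    (v : (Θ.free X₁ X₂).V) : b (Θ.liftV hH f g v) = Θ.liftV hH' (a ∘ f) (b ∘ g) v :=
  congrFun (free_hom_ext₂ ((isHom_lift hH f g).comp h) (isHom_lift hH' (a ∘ f) (b ∘ g))
    (fun x => by simp only [Function.comp_apply, liftL_gen₁])
    (fun y => by simp only [Function.comp_apply, liftV_gen₂])) v

theorem liftL_gen₁_eq_self (l : (Θ.free X₁ X₂).L) :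
    Θ.liftL (Θ.free_mem X₁ X₂) Θ.gen₁ l = l :=
  congrFun (free_hom_ext₁ (isHom_lift _ _ Θ.gen₂) (.id _) fun x => Θ.liftL_gen₁ _ _ x) l

theorem liftV_gen₂_eq_self (v : (Θ.free X₁ X₂).V) :
    Θ.liftV (Θ.free_mem X₁ X₂) Θ.gen₁ Θ.gen₂ v = v :=
  congrFun (free_hom_ext₂ (isHom_lift _ _ _) (.id _) (fun x => Θ.liftL_gen₁ _ _ x)
    fun y => Θ.liftV_gen₂ _ _ _ y) v

end Hom

section SmallGeneratingSets

variable {Θ} {X₁ X₂ : Finset ℕ}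

theorem span_range_gen₁_eq_top [Subsingleton X₁] :
    Submodule.span k (Set.range (Θ.gen₁ : X₁ → (Θ.free X₁ X₂).L)) = ⊤ := by
  refine submodule_eq_top_of_gen₁_mem (fun x => Submodule.subset_span ⟨x, rfl⟩) fun x v hv => ?_
  induction hv using Submodule.span_induction with
  | mem v hv =>
    obtain ⟨y, rfl⟩ := hv
    rw [Subsingleton.elim x y, lie_self]
    exact Submodule.zero_mem _
  | zero =>
    rw [lie_zero]
    exact Submodule.zero_mem _
  | add v w _ _ hv hw =>
    rw [lie_add]
    exact Submodule.add_mem _ hv hw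
  | smul c v _ hv =>
    rw [lie_smul]
    exact Submodule.smul_mem _ c hv

theorem span_range_gen₂_eq_top [IsEmpty X₁] :
    Submodule.span k (Set.range (Θ.gen₂ : X₂ → (Θ.free X₁ X₂).V)) = ⊤ :=
  submodule_eq_top_of_gen₂_mem (fun y => Submodule.subset_span ⟨y, rfl⟩) isEmptyElim

instance [IsEmpty X₁] : Subsingleton (Θ.free X₁ X₂).L :=
  (Submodule.subsingleton_iff k).1 <| subsingleton_of_bot_eq_top <|
    submodule_eq_top_of_gen₁_mem isEmptyElim isEmptyElim

instance [IsEmpty X₂] : Subsingleton (Θ.free X₁ X₂).V :=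
  (Submodule.subsingleton_iff k).1 <| subsingleton_of_bot_eq_top <|
    submodule_eq_top_of_gen₂_mem isEmptyElim fun x v hv => by
      rw [(Submodule.mem_bot k).1 hv, map_zero]
      exact Submodule.zero_mem _

end SmallGeneratingSets

section Nondegenerate

variable {Θ} {X₁ X₂ : Finset ℕ}

theorem gen₁_ne_zero (hnd : ¬Θ.IsDegenerated) (x : X₁) : (Θ.gen₁ x : (Θ.free X₁ X₂).L) ≠ 0 :=
  fun h => hnd fun H hH l₁ l₂ v => by
    have hlie := congrArg (Θ.liftL hH fun _ => ⁅l₁, l₂⁆) h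
    rw [map_zero, liftL_gen₁] at hlie
    rw [hlie, map_zero, LinearMap.zero_apply]

theorem gen₂_ne_zero (hnd : ¬Θ.IsDegenerated) (y : X₂) : (Θ.gen₂ y : (Θ.free X₁ X₂).V) ≠ 0 :=
  fun h => hnd fun H hH l₁ l₂ v => by
    have hv := congrArg (Θ.liftV hH 0 fun _ => v) h
    rw [map_zero, liftV_gen₂] at hv
    rw [hv, map_zero]

theorem act_gen_ne_zero (hnd : ¬Θ.IsDegenerated) (x : X₁) (y : X₂) :
    (Θ.free X₁ X₂).act (Θ.gen₁ x) (Θ.gen₂ y) ≠ 0 :=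
  fun h => hnd fun H hH l₁ l₂ v => by
    have hact := congrArg (Θ.liftV hH (fun _ => ⁅l₁, l₂⁆) fun _ => v) h
    rwa [map_zero, liftV_act, liftL_gen₁, liftV_gen₂] at hact

theorem act_lie_gen_ne_zero (hnd : ¬Θ.IsDegenerated) {x₁ x₂ : X₁} (hx : x₁ ≠ x₂) (y : X₂) :
    (Θ.free X₁ X₂).act ⁅(Θ.gen₁ x₁ : (Θ.free X₁ X₂).L), (Θ.gen₁ x₂ : (Θ.free X₁ X₂).L)⁆
      (Θ.gen₂ y) ≠ 0 :=
  fun h => hnd fun H hH l₁ l₂ v => by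
    classical
    have hact := congrArg (Θ.liftV hH (Function.update (fun _ => l₂) x₁ l₁) fun _ => v) h
    rwa [map_zero, liftV_act, liftL_lie, liftL_gen₁, liftL_gen₁, liftV_gen₂,
      Function.update_self, Function.update_of_ne hx.symm] at hact

end Nondegenerate

section Scaling

variable {X₁ X₂ : Finset ℕ}

/-- The first-sort component of the diagonal endomorphism of `F_Θ(X)` that multiplies every
generator `x` of the first sort by `c x` and fixes the generators of the second sort. -/
noncomputable def scaleL (X₂ : Finset ℕ) (c : X₁ → k) : Module.End k (Θ.free X₁ X₂).L :=
  Θ.liftL (Θ.free_mem X₁ X₂) fun x => c x • Θ.gen₁ x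

/-- The second-sort component of the diagonal endomorphism of `F_Θ(X)` that multiplies every
generator `x` of the first sort by `c x` and fixes the generators of the second sort. -/
noncomputable def scaleV (X₂ : Finset ℕ) (c : X₁ → k) : Module.End k (Θ.free X₁ X₂).V :=
  Θ.liftV (Θ.free_mem X₁ X₂) (fun x => c x • Θ.gen₁ x) Θ.gen₂

variable {Θ}

theorem scaleL_gen₁ (c : X₁ → k) (x : X₁) : Θ.scaleL X₂ c (Θ.gen₁ x) = c x • Θ.gen₁ x :=
  Θ.liftL_gen₁ _ _ x

theorem scaleL_lie (c : X₁ → k) (l m : (Θ.free X₁ X₂).L) :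
    Θ.scaleL X₂ c ⁅l, m⁆ = ⁅Θ.scaleL X₂ c l, Θ.scaleL X₂ c m⁆ :=
  Θ.liftL_lie _ _ l m

theorem scaleV_gen₂ (c : X₁ → k) (y : X₂) : Θ.scaleV X₂ c (Θ.gen₂ y) = Θ.gen₂ y :=
  Θ.liftV_gen₂ _ _ _ y

theorem scaleV_act (c : X₁ → k) (l : (Θ.free X₁ X₂).L) (v : (Θ.free X₁ X₂).V) :
    Θ.scaleV X₂ c ((Θ.free X₁ X₂).act l v) =
      (Θ.free X₁ X₂).act (Θ.scaleL X₂ c l) (Θ.scaleV X₂ c v) :=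
  Θ.liftV_act _ _ _ l v

/-- The right-normed bracket `[x₁, [x₂, ⋯ [xₙ, y]]]` of generators of `F_Θ(X)`. -/
noncomputable def lieWord (X₂ : Finset ℕ) : List X₁ × X₁ → (Θ.free X₁ X₂).L :=
  wordVector (fun x => (LieAlgebra.ad k (Θ.free X₁ X₂).L (Θ.gen₁ x) :)) Θ.gen₁

/-- The monomial `x₁ ∘ (x₂ ∘ ⋯ (xₙ ∘ y))` in the generators of `F_Θ(X)`. -/
noncomputable def actWord : List X₁ × X₂ → (Θ.free X₁ X₂).V :=
  wordVector (fun x => (Θ.free X₁ X₂).act (Θ.gen₁ x)) Θ.gen₂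

theorem mem_span_lieWord_of_scaleL {J : Type*} {c : J → X₁ → k} {χ : J → k}
    {l : (Θ.free X₁ X₂).L} (hl : ∀ j, Θ.scaleL X₂ (c j) l = χ j • l) :
    l ∈ Submodule.span k (lieWord X₂ '' {p | ∀ j, ((p.1 ++ [p.2]).map (c j)).prod = χ j}) := by
  have hword (p : List X₁ × X₁) (j : J) : Θ.scaleL X₂ (c j) (lieWord X₂ p) =
      ((p.1 ++ [p.2]).map (c j)).prod • lieWord X₂ p := by
    rw [List.map_append, List.prod_append, List.map_singleton, List.prod_singleton]
    exact map_wordVector (fun x => scaleL_gen₁ (c j) x)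
      (fun x v => by simp only [LieAlgebra.ad_apply, scaleL_lie, scaleL_gen₁, smul_lie]) p
  have hspan : Submodule.span k (Set.range (lieWord (Θ := Θ) (X₁ := X₁) X₂)) = ⊤ :=
    span_range_wordVector fun N => submodule_eq_top_of_gen₁_mem
  simpa only [funext_iff] using mem_span_image_of_forall_eq_smul hword hspan hl

theorem mem_span_actWord_of_scaleV {J : Type*} {c : J → X₁ → k} {χ : J → k}
    {v : (Θ.free X₁ X₂).V} (hv : ∀ j, Θ.scaleV X₂ (c j) v = χ j • v) :
    v ∈ Submodule.span k (actWord '' {p | ∀ j, (p.1.map (c j)).prod = χ j}) := by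
  have hword (p : List X₁ × X₂) (j : J) : Θ.scaleV X₂ (c j) (actWord p) =
      (p.1.map (c j)).prod • actWord p := by
    rw [actWord, map_wordVector (α := c j) (β := 1)
      (fun y => by rw [scaleV_gen₂, Pi.one_apply, one_smul])
      (fun x v => by rw [scaleV_act, scaleL_gen₁, map_smul, LinearMap.smul_apply]) p,
      Pi.one_apply, mul_one]
  have hspan : Submodule.span k (Set.range (actWord (Θ := Θ) (X₁ := X₁) (X₂ := X₂))) = ⊤ :=
    span_range_wordVector fun N => submodule_eq_top_of_gen₂_mem
  simpa only [funext_iff] using mem_span_image_of_forall_eq_smul hword hspan hv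

theorem mem_span_gen₁_of_scaleL_const [Infinite k] {l : (Θ.free X₁ X₂).L}
    (hl : ∀ c : k, Θ.scaleL X₂ (fun _ => c) l = c • l) :
    l ∈ Submodule.span k (Set.range (Θ.gen₁ : X₁ → (Θ.free X₁ X₂).L)) := by
  refine Submodule.span_mono ?_ (mem_span_lieWord_of_scaleL hl)
  rintro _ ⟨⟨w, x⟩, hw, rfl⟩
  have hlength : w.length + 1 = 1 := eq_of_forall_pow_eq_pow (k := k) fun c => by
    simpa [pow_succ] using hw c
  obtain rfl : w = [] := List.length_eq_zero_iff.1 (Nat.succ_injective hlength)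
  exact ⟨x, rfl⟩

theorem mem_span_lie_of_scaleL [Infinite k] {x y : X₁} {l : (Θ.free X₁ X₂).L}
    (hl : ∀ c : X₁ → k, Θ.scaleL X₂ c l = (c x * c y) • l) :
    l ∈ Submodule.span k {⁅(Θ.gen₁ x : (Θ.free X₁ X₂).L), (Θ.gen₁ y : (Θ.free X₁ X₂).L)⁆} := by
  refine Submodule.span_le.2 ?_ (mem_span_lieWord_of_scaleL hl)
  rintro _ ⟨⟨w, z⟩, hw, rfl⟩
  have hperm : (w ++ [z]).Perm [x, y] := perm_of_forall_prod_map_eq_prod_map (k := k) fun c => by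
    rw [hw c, List.map_cons, List.map_singleton, List.prod_pair]
  have hlength : w.length = 1 := by simpa using hperm.length_eq
  obtain ⟨u, rfl⟩ := List.length_eq_one_iff.1 hlength
  have hword : lieWord X₂ ([u], z) = ⁅(Θ.gen₁ u : (Θ.free X₁ X₂).L), Θ.gen₁ z⁆ := rfl
  rw [SetLike.mem_coe, hword]
  rcases List.perm_pair.1 hperm with h | h <;> obtain ⟨rfl, rfl⟩ := by simpa using h
  · exact Submodule.mem_span_singleton_self _
  · rw [← lie_skew (Θ.gen₁ u : (Θ.free X₁ X₂).L), Submodule.neg_mem_iff]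
    exact Submodule.mem_span_singleton_self _

theorem exists_pow_eq_of_scaleV_const {J : Type*} {c χ : J → k} {v : (Θ.free X₁ X₂).V}
    (hv₀ : v ≠ 0) (hv : ∀ j, Θ.scaleV X₂ (fun _ => c j) v = χ j • v) :
    ∃ n : ℕ, ∀ j, c j ^ n = χ j := by
  have hmem := mem_span_actWord_of_scaleV hv
  obtain ⟨_, ⟨p, hp, rfl⟩⟩ : (actWord (Θ := Θ) ''
      {p : List X₁ × X₂ | ∀ j, (p.1.map fun _ => c j).prod = χ j}).Nonempty := by
    by_contra! hempty
    rw [hempty, Submodule.span_empty] at hmem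
    exact hv₀ ((Submodule.mem_bot k).1 hmem)
  exact ⟨p.1.length, fun j => by simpa using hp j⟩

theorem mem_span_act_of_scaleV_const [Infinite k] {v : (Θ.free X₁ X₂).V}
    (hv : ∀ c : k, Θ.scaleV X₂ (fun _ => c) v = c • v) :
    v ∈ Submodule.span k
      (Set.range fun p : X₁ × X₂ => (Θ.free X₁ X₂).act (Θ.gen₁ p.1) (Θ.gen₂ p.2)) := by
  refine Submodule.span_mono ?_ (mem_span_actWord_of_scaleV hv)
  rintro _ ⟨⟨w, y⟩, hw, rfl⟩
  have hlength : w.length = 1 := eq_of_forall_pow_eq_pow (k := k) fun c => by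
    simpa using hw c
  obtain ⟨x, rfl⟩ := List.length_eq_one_iff.1 hlength
  exact ⟨(x, y), rfl⟩

end Scaling

end Variety

namespace WordSystem

variable {k : Type u} [Field k] {Θ : Variety k} {W : WordSystem Θ}

section Operations

theorem zero₁_eq_zero : W.zero₁ = 0 := Subsingleton.elim _ _

theorem zero₂_eq_zero : W.zero₂ = 0 := Subsingleton.elim _ _

variable {H : Rep k} (hH : H ∈ Θ.carrier)

theorem operations_zero₁ : (W.operations hH).zero₁ = 0 := by
  simp only [operations, zero₁_eq_zero, map_zero]

theorem operations_zero₂ : (W.operations hH).zero₂ = 0 := by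
  simp only [operations, zero₂_eq_zero, map_zero]

theorem operations_smul₁ {c d : k} (h : W.smul₁ c = d • Θ.gen₁ var) (l : H.L) :
    (W.operations hH).smul₁ c l = d • l := by
  simp only [operations, h, map_smul, Variety.liftL_gen₁, assign₁]

theorem operations_smul₂ {c d : k} (h : W.smul₂ c = d • Θ.gen₂ var) (v : H.V) :
    (W.operations hH).smul₂ c v = d • v := by
  simp only [operations, h, map_smul, Variety.liftV_gen₂, assign₁]

theorem operations_add₁ {c d : k} (h : W.add₁ = c • Θ.gen₁ var₁ + d • Θ.gen₁ var₂)
    (l m : H.L) : (W.operations hH).add₁ l m = c • l + d • m := by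
  simp only [operations, h, map_add, map_smul, Variety.liftL_gen₁]
  rfl

theorem operations_add₂ {c d : k} (h : W.add₂ = c • Θ.gen₂ var₁ + d • Θ.gen₂ var₂)
    (v w : H.V) : (W.operations hH).add₂ v w = c • v + d • w := by
  simp only [operations, h, map_add, map_smul, Variety.liftV_gen₂]
  rfl

theorem operations_bracket {a : k}
    (h : W.bracket = a • ⁅(Θ.gen₁ var₁ : (Θ.free {0, 1} ∅).L), Θ.gen₁ var₂⁆) (l m : H.L) :
    (W.operations hH).bracket l m = a • ⁅l, m⁆ := by
  simp only [operations, h, map_smul, Variety.liftL_lie, Variety.liftL_gen₁]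
  rfl

theorem operations_act {b : k}
    (h : W.act = b • (Θ.free {0} {0}).act (Θ.gen₁ var) (Θ.gen₂ var)) (l : H.L) (v : H.V) :
    (W.operations hH).act l v = b • H.act l v := by
  simp only [operations, h, map_smul, Variety.liftV_act, Variety.liftL_gen₁,
    Variety.liftV_gen₂, assign₁]

theorem isHom_operations {H' : Rep k} {hH : H ∈ Θ.carrier}
    (hH' : H' ∈ Θ.carrier) {a : H.L → H'.L} {b : H.V → H'.V}
    (h : IsHom H.operations H'.operations a b) :
    IsHom (W.operations hH) (W.operations hH') a b := by
  constructor <;> intros <;>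
    simp only [operations, Variety.hom_liftL (hH' := hH') h, Variety.hom_liftV (hH' := hH') h,
      comp_assign₀, comp_assign₁, comp_assign₂]

end Operations

/-- An isomorphism from `F = F_Θ(X)` to `F_W^*` that fixes the free generators, as in the definition
of `IsVerbal`. -/
structure VerbalIso (W : WordSystem Θ) (X₁ X₂ : Finset ℕ) where
  equivL : (Θ.free X₁ X₂).L ≃ (Θ.free X₁ X₂).L
  equivV : (Θ.free X₁ X₂).V ≃ (Θ.free X₁ X₂).V
  equivL_gen₁ : ∀ x, equivL (Θ.gen₁ x) = Θ.gen₁ x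
  equivV_gen₂ : ∀ y, equivV (Θ.gen₂ y) = Θ.gen₂ y
  isHom : IsHom (Θ.free X₁ X₂).operations (W.operations (Θ.free_mem X₁ X₂)) equivL equivV

theorem IsVerbal.nonempty_verbalIso (hW : W.IsVerbal) (X₁ X₂ : Finset ℕ) :
    Nonempty (W.VerbalIso X₁ X₂) :=
  let ⟨s₁, s₂, hs₁, hs₂, hs⟩ := hW X₁ X₂
  ⟨⟨s₁, s₂, hs₁, hs₂, hs⟩⟩

namespace VerbalIso

section Words

theorem equivL_neg_gen₁ (s : W.VerbalIso {0} ∅) : s.equivL (-Θ.gen₁ var) = W.neg₁ := by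
  refine (s.isHom.neg₁ _).trans ?_
  simp only [s.equivL_gen₁, operations, assign₁_apply_var, Variety.liftL_gen₁_eq_self]

theorem equivL_add_gen₁ (s : W.VerbalIso {0, 1} ∅) :
    s.equivL (Θ.gen₁ var₁ + Θ.gen₁ var₂) = W.add₁ := by
  refine (s.isHom.add₁ _ _).trans ?_
  simp only [s.equivL_gen₁, operations, assign₂_apply_var, Variety.liftL_gen₁_eq_self]

theorem equivL_lie_gen₁ (s : W.VerbalIso {0, 1} ∅) :
    s.equivL ⁅(Θ.gen₁ var₁ : (Θ.free {0, 1} ∅).L), Θ.gen₁ var₂⁆ = W.bracket := by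
  refine (s.isHom.bracket _ _).trans ?_
  simp only [s.equivL_gen₁, operations, assign₂_apply_var, Variety.liftL_gen₁_eq_self]

theorem equivV_neg_gen₂ (s : W.VerbalIso ∅ {0}) : s.equivV (-Θ.gen₂ var) = W.neg₂ := by
  refine (s.isHom.neg₂ _).trans ?_
  simp only [s.equivV_gen₂, operations, assign₀_eq Θ.gen₁, assign₁_apply_var,
    Variety.liftV_gen₂_eq_self]

theorem equivV_act_gen (s : W.VerbalIso {0} {0}) :
    s.equivV ((Θ.free {0} {0}).act (Θ.gen₁ var) (Θ.gen₂ var)) = W.act := by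
  refine (s.isHom.act _ _).trans ?_
  simp only [s.equivL_gen₁, s.equivV_gen₂, operations, assign₁_apply_var,
    Variety.liftV_gen₂_eq_self]

end Words

variable {X₁ X₂ : Finset ℕ} (s : W.VerbalIso X₁ X₂)

theorem equivL_zero : s.equivL 0 = 0 := s.isHom.zero₁.trans (operations_zero₁ _)

theorem equivV_zero : s.equivV 0 = 0 := s.isHom.zero₂.trans (operations_zero₂ _)

theorem equivL_smul {c d : k} (h : W.smul₁ c = d • Θ.gen₁ var) (l : (Θ.free X₁ X₂).L) :
    s.equivL (c • l) = d • s.equivL l :=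
  (s.isHom.smul₁ c l).trans (operations_smul₁ _ h _)

theorem equivV_smul {c d : k} (h : W.smul₂ c = d • Θ.gen₂ var) (v : (Θ.free X₁ X₂).V) :
    s.equivV (c • v) = d • s.equivV v :=
  (s.isHom.smul₂ c v).trans (operations_smul₂ _ h _)

theorem equivL_add {c d : k} (h : W.add₁ = c • Θ.gen₁ var₁ + d • Θ.gen₁ var₂)
    (l m : (Θ.free X₁ X₂).L) : s.equivL (l + m) = c • s.equivL l + d • s.equivL m :=
  (s.isHom.add₁ l m).trans (operations_add₁ _ h _ _)

theorem equivV_add {c d : k} (h : W.add₂ = c • Θ.gen₂ var₁ + d • Θ.gen₂ var₂)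
    (v w : (Θ.free X₁ X₂).V) : s.equivV (v + w) = c • s.equivV v + d • s.equivV w :=
  (s.isHom.add₂ v w).trans (operations_add₂ _ h _ _)

theorem equivL_lie {a : k}
    (h : W.bracket = a • ⁅(Θ.gen₁ var₁ : (Θ.free {0, 1} ∅).L), Θ.gen₁ var₂⁆)
    (l m : (Θ.free X₁ X₂).L) : s.equivL ⁅l, m⁆ = a • ⁅s.equivL l, s.equivL m⁆ :=
  (s.isHom.bracket l m).trans (operations_bracket _ h _ _)

theorem equivV_act {b : k}
    (h : W.act = b • (Θ.free {0} {0}).act (Θ.gen₁ var) (Θ.gen₂ var))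
    (l : (Θ.free X₁ X₂).L) (v : (Θ.free X₁ X₂).V) :
    s.equivV ((Θ.free X₁ X₂).act l v) = b • (Θ.free X₁ X₂).act (s.equivL l) (s.equivV v) :=
  (s.isHom.act l v).trans (operations_act _ h _ _)

theorem equivL_liftL (f : X₁ → (Θ.free X₁ X₂).L) (l : (Θ.free X₁ X₂).L) :
    s.equivL (Θ.liftL (Θ.free_mem X₁ X₂) f l) =
      Θ.liftL (Θ.free_mem X₁ X₂) (s.equivL ∘ f) (s.equivL l) := by
  have hleft := (Variety.isHom_lift (Θ.free_mem X₁ X₂) f Θ.gen₂).comp s.isHom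
  have hright := s.isHom.comp (isHom_operations (W := W) (hH := Θ.free_mem X₁ X₂)
    (Θ.free_mem X₁ X₂) (Variety.isHom_lift (Θ.free_mem X₁ X₂) (s.equivL ∘ f) Θ.gen₂))
  refine congrFun (Variety.free_hom_ext₁ hleft hright fun x => ?_) l
  simp only [Function.comp_apply, Variety.liftL_gen₁, s.equivL_gen₁]

theorem equivV_liftV (f : X₁ → (Θ.free X₁ X₂).L) (g : X₂ → (Θ.free X₁ X₂).V)
    (v : (Θ.free X₁ X₂).V) :
    s.equivV (Θ.liftV (Θ.free_mem X₁ X₂) f g v) =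
      Θ.liftV (Θ.free_mem X₁ X₂) (s.equivL ∘ f) (s.equivV ∘ g) (s.equivV v) := by
  have hleft := (Variety.isHom_lift (Θ.free_mem X₁ X₂) f g).comp s.isHom
  have hright := s.isHom.comp (isHom_operations (W := W) (hH := Θ.free_mem X₁ X₂)
    (Θ.free_mem X₁ X₂) (Variety.isHom_lift (Θ.free_mem X₁ X₂) (s.equivL ∘ f) (s.equivV ∘ g)))
  refine congrFun (Variety.free_hom_ext₂ hleft hright (fun x => ?_) fun y => ?_) v
  · simp only [Function.comp_apply, Variety.liftL_gen₁, s.equivL_gen₁]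
  · simp only [Function.comp_apply, Variety.liftV_gen₂, s.equivV_gen₂]

variable {φ : k → k} (hφ : ∀ c, W.smul₁ c = φ c • Θ.gen₁ var)
include hφ

theorem equivL_scaleL (c : X₁ → k) (l : (Θ.free X₁ X₂).L) :
    s.equivL (Θ.scaleL X₂ c l) = Θ.scaleL X₂ (φ ∘ c) (s.equivL l) := by
  simp only [Variety.scaleL, equivL_liftL, Function.comp_def, s.equivL_smul (hφ _),
    s.equivL_gen₁]

theorem equivV_scaleV (c : X₁ → k) (v : (Θ.free X₁ X₂).V) :
    s.equivV (Θ.scaleV X₂ c v) = Θ.scaleV X₂ (φ ∘ c) (s.equivV v) := by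
  simp only [Variety.scaleV, equivV_liftV, Function.comp_def, s.equivL_smul (hφ _),
    s.equivL_gen₁, s.equivV_gen₂]

end VerbalIso

section Scalars

theorem exists_mulEquiv_smul₁ (hnd : ¬Θ.IsDegenerated) (hW : W.IsVerbal) :
    ∃ φ : k ≃* k, ∀ c, W.smul₁ c = φ c • Θ.gen₁ var := by
  obtain ⟨s⟩ := hW.nonempty_verbalIso {0} ∅
  have hspan (l : (Θ.free {0} ∅).L) : ∃ c : k, c • Θ.gen₁ var = l := by
    rw [← Submodule.mem_span_singleton, ← range_eq_singleton_of_subsingleton,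
      Variety.span_range_gen₁_eq_top]
    trivial
  choose φ hφ using fun c => hspan (W.smul₁ c)
  obtain ⟨ψ, hψ⟩ := exists_mulEquiv_of_map_smul (Variety.gen₁_ne_zero hnd var) hspan s.equivL
    (s.equivL_gen₁ var) fun c => s.equivL_smul (hφ c).symm
  exact ⟨ψ, fun c => by rw [hψ, hφ]⟩

theorem exists_mulEquiv_smul₂ (hnd : ¬Θ.IsDegenerated) (hW : W.IsVerbal) :
    ∃ ψ : k ≃* k, ∀ c, W.smul₂ c = ψ c • Θ.gen₂ var := by
  obtain ⟨s⟩ := hW.nonempty_verbalIso ∅ {0}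
  have hspan (v : (Θ.free ∅ {0}).V) : ∃ c : k, c • Θ.gen₂ var = v := by
    rw [← Submodule.mem_span_singleton, ← range_eq_singleton_of_subsingleton,
      Variety.span_range_gen₂_eq_top]
    trivial
  choose ψ hψ using fun c => hspan (W.smul₂ c)
  obtain ⟨θ, hθ⟩ := exists_mulEquiv_of_map_smul (Variety.gen₂_ne_zero hnd var) hspan s.equivV
    (s.equivV_gen₂ var) fun c => s.equivV_smul (hψ c).symm
  exact ⟨θ, fun c => by rw [hθ, hψ]⟩

theorem neg₁_eq {d : k} (hW : W.IsVerbal) (h : W.smul₁ (-1) = d • Θ.gen₁ var) :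
    W.neg₁ = d • Θ.gen₁ var := by
  obtain ⟨s⟩ := hW.nonempty_verbalIso {0} ∅
  rw [← s.equivL_neg_gen₁, ← neg_one_smul k, s.equivL_smul h, s.equivL_gen₁]

theorem neg₂_eq {d : k} (hW : W.IsVerbal) (h : W.smul₂ (-1) = d • Θ.gen₂ var) :
    W.neg₂ = d • Θ.gen₂ var := by
  obtain ⟨s⟩ := hW.nonempty_verbalIso ∅ {0}
  rw [← s.equivV_neg_gen₂, ← neg_one_smul k, s.equivV_smul h, s.equivV_gen₂]

end Scalars

section Addition

theorem add₂_eq (hnd : ¬Θ.IsDegenerated) (hW : W.IsVerbal) :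
    W.add₂ = Θ.gen₂ var₁ + Θ.gen₂ var₂ := by
  have hmem : W.add₂ ∈ Submodule.span k {Θ.gen₂ var₁, Θ.gen₂ var₂} := by
    rw [← range_eq_pair_of_var, Variety.span_range_gen₂_eq_top]
    trivial
  obtain ⟨c, d, hcd⟩ := Submodule.mem_span_pair.1 hmem
  obtain ⟨s⟩ := hW.nonempty_verbalIso ∅ {0}
  obtain ⟨rfl, rfl⟩ := eq_one_and_eq_one_of_map_add (Variety.gen₂_ne_zero hnd var)
    s.equivV_zero (s.equivV_gen₂ var) (s.equivV_add hcd.symm)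
  rw [← hcd, one_smul, one_smul]

theorem add₁_eq [Infinite k] (hnd : ¬Θ.IsDegenerated) (hW : W.IsVerbal) :
    W.add₁ = Θ.gen₁ var₁ + Θ.gen₁ var₂ := by
  obtain ⟨φ, hφ⟩ := exists_mulEquiv_smul₁ hnd hW
  have hmem : W.add₁ ∈ Submodule.span k {Θ.gen₁ var₁, Θ.gen₁ var₂} := by
    obtain ⟨s⟩ := hW.nonempty_verbalIso {0, 1} ∅
    rw [← range_eq_pair_of_var]
    refine Variety.mem_span_gen₁_of_scaleL_const (φ.surjective.forall.2 fun c => ?_)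
    rw [← s.equivL_add_gen₁, ← s.equivL_smul (hφ c), smul_add]
    refine (s.equivL_scaleL hφ (fun _ => c) _).symm.trans ?_
    rw [map_add, Variety.scaleL_gen₁, Variety.scaleL_gen₁]
  obtain ⟨c, d, hcd⟩ := Submodule.mem_span_pair.1 hmem
  obtain ⟨s⟩ := hW.nonempty_verbalIso {0} ∅
  obtain ⟨rfl, rfl⟩ := eq_one_and_eq_one_of_map_add (Variety.gen₁_ne_zero hnd var)
    s.equivL_zero (s.equivL_gen₁ var) (s.equivL_add hcd.symm)
  rw [← hcd, one_smul, one_smul]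

theorem exists_ringEquiv_smul₁ [Infinite k] (hnd : ¬Θ.IsDegenerated) (hW : W.IsVerbal) :
    ∃ φ : k ≃+* k, ∀ c, W.smul₁ c = φ c • Θ.gen₁ var := by
  obtain ⟨φ, hφ⟩ := exists_mulEquiv_smul₁ hnd hW
  obtain ⟨s⟩ := hW.nonempty_verbalIso {0} ∅
  have hsmul (c : k) : s.equivL (c • Θ.gen₁ var) = φ c • Θ.gen₁ var := by
    rw [s.equivL_smul (hφ c), s.equivL_gen₁]
  have hadd (c d : k) : φ (c + d) = φ c + φ d := by
    have hadd₁ : W.add₁ = (1 : k) • Θ.gen₁ var₁ + (1 : k) • Θ.gen₁ var₂ := by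
      rw [one_smul, one_smul, add₁_eq hnd hW]
    have h := s.equivL_add hadd₁ (c • Θ.gen₁ var) (d • Θ.gen₁ var)
    rw [← add_smul, hsmul, hsmul, hsmul, one_smul, one_smul, ← add_smul] at h
    exact smul_left_injective k (Variety.gen₁_ne_zero hnd var) h
  exact ⟨{ φ with map_add' := hadd }, hφ⟩

end Addition

section Products

theorem exists_bracket_eq [Infinite k] (hnd : ¬Θ.IsDegenerated) (hW : W.IsVerbal) :
    ∃ a : k, W.bracket = a • ⁅(Θ.gen₁ var₁ : (Θ.free {0, 1} ∅).L), Θ.gen₁ var₂⁆ := by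
  obtain ⟨φ, hφ⟩ := exists_mulEquiv_smul₁ hnd hW
  obtain ⟨s⟩ := hW.nonempty_verbalIso {0, 1} ∅
  have hscale (c : ({0, 1} : Finset ℕ) → k) :
      Θ.scaleL ∅ (φ ∘ c) W.bracket = (φ (c var₁) * φ (c var₂)) • W.bracket := by
    rw [← s.equivL_lie_gen₁, ← s.equivL_scaleL hφ, Variety.scaleL_lie, Variety.scaleL_gen₁,
      Variety.scaleL_gen₁, smul_lie, lie_smul, s.equivL_smul (hφ _), s.equivL_smul (hφ _),
      smul_smul]
  obtain ⟨a, ha⟩ := Submodule.mem_span_singleton.1 <|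
    Variety.mem_span_lie_of_scaleL (φ.surjective.comp_left.forall.2 hscale)
  exact ⟨a, ha.symm⟩

variable {φ ψ : k ≃* k}

theorem scaleV_act_word (hW : W.IsVerbal) (hφ : ∀ c, W.smul₁ c = φ c • Θ.gen₁ var)
    (hψ : ∀ c, W.smul₂ c = ψ c • Θ.gen₂ var) (c : k) :
    Θ.scaleV {0} (fun _ => φ c) W.act = ψ c • W.act := by
  obtain ⟨s⟩ := hW.nonempty_verbalIso {0} {0}
  rw [← s.equivV_act_gen, ← s.equivV_smul (hψ c)]
  refine (s.equivV_scaleV hφ (fun _ => c) _).symm.trans ?_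
  rw [Variety.scaleV_act, Variety.scaleL_gen₁, Variety.scaleV_gen₂, map_smul,
    LinearMap.smul_apply]

theorem act_word_ne_zero (hnd : ¬Θ.IsDegenerated) (hW : W.IsVerbal) : W.act ≠ 0 := by
  obtain ⟨s⟩ := hW.nonempty_verbalIso {0} {0}
  rw [← s.equivV_act_gen, ← s.equivV_zero]
  exact s.equivV.injective.ne (Variety.act_gen_ne_zero hnd var var)

theorem exists_pow_eq_symm_apply (hnd : ¬Θ.IsDegenerated) (hW : W.IsVerbal)
    (hφ : ∀ c, W.smul₁ c = φ c • Θ.gen₁ var) (hψ : ∀ c, W.smul₂ c = ψ c • Θ.gen₂ var) :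
    ∃ m : ℕ, ∀ c, c ^ m = ψ.symm (φ c) := by
  obtain ⟨s⟩ := hW.nonempty_verbalIso {0} {0}
  let u := s.equivV.symm ((Θ.free {0} {0}).act (Θ.gen₁ var) (Θ.gen₂ var))
  have hsu : s.equivV u = (Θ.free {0} {0}).act (Θ.gen₁ var) (Θ.gen₂ var) :=
    s.equivV.apply_symm_apply _
  have hu : u ≠ 0 := fun h => Variety.act_gen_ne_zero hnd var var <| by
    rw [← hsu, h, s.equivV_zero]
  refine Variety.exists_pow_eq_of_scaleV_const hu fun c => s.equivV.injective ?_
  rw [s.equivV_smul (hψ _), ψ.apply_symm_apply, s.equivV_scaleV hφ, hsu, Variety.scaleV_act,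
    Variety.scaleL_gen₁, Variety.scaleV_gen₂, map_smul, LinearMap.smul_apply,
    Function.comp_apply]

-- The action gives `ψ = φ ^ n`, and the inverse of the verbal isomorphism gives
-- `ψ⁻¹ ∘ φ = (· ^ m)`; hence `φ = φ ^ (n * m)` and `n = 1`.
theorem mulEquiv_smul₁_eq_smul₂ [Infinite k] (hnd : ¬Θ.IsDegenerated) (hW : W.IsVerbal)
    (hφ : ∀ c, W.smul₁ c = φ c • Θ.gen₁ var) (hψ : ∀ c, W.smul₂ c = ψ c • Θ.gen₂ var) :
    φ = ψ := by
  obtain ⟨n, hn⟩ := Variety.exists_pow_eq_of_scaleV_const (act_word_ne_zero hnd hW)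
    (scaleV_act_word hW hφ hψ)
  obtain ⟨m, hm⟩ := exists_pow_eq_symm_apply hnd hW hφ hψ
  have hnm : n * m = 1 := eq_of_forall_pow_eq_pow <| φ.surjective.forall.2 fun c => by
    rw [pow_mul, hn, ← map_pow, hm, ψ.apply_symm_apply, pow_one]
  obtain rfl := Nat.eq_one_of_mul_eq_one_right hnm
  exact MulEquiv.ext fun c => by rw [← hn, pow_one]

theorem exists_act_eq [Infinite k] (hnd : ¬Θ.IsDegenerated) (hW : W.IsVerbal) :
    ∃ b : k, b ≠ 0 ∧ W.act = b • (Θ.free {0} {0}).act (Θ.gen₁ var) (Θ.gen₂ var) := by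
  obtain ⟨φ, hφ⟩ := exists_mulEquiv_smul₁ hnd hW
  obtain ⟨ψ, hψ⟩ := exists_mulEquiv_smul₂ hnd hW
  obtain rfl := mulEquiv_smul₁_eq_smul₂ hnd hW hφ hψ
  have hmem := Variety.mem_span_act_of_scaleV_const
    (φ.surjective.forall.2 (scaleV_act_word hW hφ hψ))
  rw [range_eq_singleton_of_subsingleton _ (var, var), Submodule.mem_span_singleton] at hmem
  obtain ⟨b, hb⟩ := hmem
  refine ⟨b, ?_, hb.symm⟩
  rintro rfl
  exact act_word_ne_zero hnd hW (hb.symm.trans (zero_smul k _))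

-- Apply the verbal isomorphism to `[x₁, x₂] ∘ y = x₁ ∘ (x₂ ∘ y) - x₂ ∘ (x₁ ∘ y)`: this
-- multiplies the left-hand side by `a * b` and the right-hand side by `b ^ 2`.
theorem bracket_coeff_eq_act_coeff (hnd : ¬Θ.IsDegenerated) (hW : W.IsVerbal) {a b : k}
    (hb₀ : b ≠ 0)
    (ha : W.bracket = a • ⁅(Θ.gen₁ var₁ : (Θ.free {0, 1} ∅).L), Θ.gen₁ var₂⁆)
    (hb : W.act = b • (Θ.free {0} {0}).act (Θ.gen₁ var) (Θ.gen₂ var)) : a = b := by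
  obtain ⟨s⟩ := hW.nonempty_verbalIso {0, 1} {0}
  let F := Θ.free {0, 1} {0}
  have hadd (v w : F.V) : s.equivV (v + w) = s.equivV v + s.equivV w := by
    have hadd₂ : W.add₂ = (1 : k) • Θ.gen₂ var₁ + (1 : k) • Θ.gen₂ var₂ := by
      rw [one_smul, one_smul, add₂_eq hnd hW]
    rw [s.equivV_add hadd₂, one_smul, one_smul]
  let x₁ : F.L := Θ.gen₁ var₁
  let x₂ : F.L := Θ.gen₁ var₂
  let y : F.V := Θ.gen₂ var
  have hleft : s.equivV (F.act ⁅x₁, x₂⁆ y) = (b * a) • F.act ⁅x₁, x₂⁆ y := by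
    rw [s.equivV_act hb, s.equivL_lie ha, s.equivL_gen₁, s.equivL_gen₁, s.equivV_gen₂,
      map_smul, LinearMap.smul_apply, smul_smul]
  have hiter (x x' : ({0, 1} : Finset ℕ)) :
      s.equivV (F.act (Θ.gen₁ x) (F.act (Θ.gen₁ x') y)) =
        (b * b) • F.act (Θ.gen₁ x) (F.act (Θ.gen₁ x') y) := by
    rw [s.equivV_act hb, s.equivV_act hb, s.equivL_gen₁, s.equivL_gen₁, s.equivV_gen₂,
      map_smul, smul_smul]
  have hright : s.equivV (F.act ⁅x₁, x₂⁆ y) = (b * b) • F.act ⁅x₁, x₂⁆ y := by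
    have hsplit : F.act ⁅x₁, x₂⁆ y + F.act x₂ (F.act x₁ y) = F.act x₁ (F.act x₂ y) := by
      rw [F.act_lie, sub_add_cancel]
    rw [F.act_lie, smul_sub, ← hiter, ← hiter, ← F.act_lie, eq_sub_iff_add_eq, ← hadd, hsplit]
  have hne : F.act ⁅x₁, x₂⁆ y ≠ 0 := Variety.act_lie_gen_ne_zero hnd (by decide) var
  exact mul_left_cancel₀ hb₀ (smul_left_injective k hne (hleft.symm.trans hright))

end Products

end WordSystem

end LieRepresentation

theorem mainTheorem4_general {k : Type u} [Field k] [Infinite k] (Θ : Variety k)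
    (hnd : ¬ Θ.IsDegenerated) (W : WordSystem Θ) (hW : W.IsVerbal) :
    ∃ (φ : k ≃+* k) (a : kˣ),
      W.zero₁ = 0 ∧
      W.neg₁ = -Θ.gen₁ var ∧
      (∀ c : k, W.smul₁ c = φ c • Θ.gen₁ var) ∧
      W.add₁ = Θ.gen₁ var₁ + Θ.gen₁ var₂ ∧
      W.bracket = (a : k) •
        ⁅(Θ.gen₁ var₁ : (Θ.free {0, 1} ∅).L), (Θ.gen₁ var₂ : (Θ.free {0, 1} ∅).L)⁆ ∧
      W.zero₂ = 0 ∧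
      W.neg₂ = -Θ.gen₂ var ∧
      (∀ c : k, W.smul₂ c = φ c • Θ.gen₂ var) ∧
      W.add₂ = Θ.gen₂ var₁ + Θ.gen₂ var₂ ∧
      W.act = (a : k) • (Θ.free {0} {0}).act (Θ.gen₁ var) (Θ.gen₂ var) := by
  obtain ⟨φ, hφ⟩ := WordSystem.exists_ringEquiv_smul₁ hnd hW
  obtain ⟨ψ, hψ⟩ := WordSystem.exists_mulEquiv_smul₂ hnd hW
  obtain rfl : φ.toMulEquiv = ψ := WordSystem.mulEquiv_smul₁_eq_smul₂ hnd hW hφ hψ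
  obtain ⟨a, ha⟩ := WordSystem.exists_bracket_eq hnd hW
  obtain ⟨b, hb₀, hb⟩ := WordSystem.exists_act_eq hnd hW
  obtain rfl : a = b := WordSystem.bracket_coeff_eq_act_coeff hnd hW hb₀ ha hb
  have hφ_neg_one : φ (-1) = -1 := by rw [map_neg, map_one]
  refine ⟨φ, Units.mk0 a hb₀, WordSystem.zero₁_eq_zero, ?_, hφ, WordSystem.add₁_eq hnd hW, ha,
    WordSystem.zero₂_eq_zero, ?_, hψ, WordSystem.add₂_eq hnd hW, hb⟩
  · rw [WordSystem.neg₁_eq hW (hφ (-1)), hφ_neg_one, neg_one_smul]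
  · rw [WordSystem.neg₂_eq hW (hψ (-1))]
    exact (congrArg (· • Θ.gen₂ var) hφ_neg_one).trans (neg_one_smul k _)

theorem mainTheorem4 {k : Type u} [Field k] [CharZero k] (Θ : Variety k)
    (hact : Θ.IsActionType) (hnd : ¬ Θ.IsDegenerated)
    (W : WordSystem Θ) (hW : W.IsVerbal) :
    ∃ (φ : k ≃+* k) (a : kˣ),
      W.zero₁ = 0 ∧
      W.neg₁ = -Θ.gen₁ var ∧
      (∀ c : k, W.smul₁ c = φ c • Θ.gen₁ var) ∧
      W.add₁ = Θ.gen₁ var₁ + Θ.gen₁ var₂ ∧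
      W.bracket = (a : k) •
        ⁅(Θ.gen₁ var₁ : (Θ.free {0, 1} ∅).L), (Θ.gen₁ var₂ : (Θ.free {0, 1} ∅).L)⁆ ∧
      W.zero₂ = 0 ∧
      W.neg₂ = -Θ.gen₂ var ∧
      (∀ c : k, W.smul₂ c = φ c • Θ.gen₂ var) ∧
      W.add₂ = Θ.gen₂ var₁ + Θ.gen₂ var₂ ∧
      W.act = (a : k) • (Θ.free {0} {0}).act (Θ.gen₁ var) (Θ.gen₂ var) :=
  mainTheorem4_general Θ hnd W hW
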